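/- **Proposition (exactness of the Poisson private representation).** Let $\mathcal X,\mathcal Z$ be measurable spaces, $Q$ a probability measure on $\mathcal Z$ (the proposal distribution), $P_{Z|X}$ a Markov kernel from $\mathcal X$ to $\mathcal Z$ (the privacy mechanism), and $\alpha\in(1,\infty]$. On a probability space let * $X$ be an $\mathcal X$-valued random variable (the input) such that $P_{Z|X}(\cdot|X)\ll Q$ almost surely, * $Z_1,Z_2,\ldots$ be i.i.d. with law $Q$ (the shared randomness), and * $(T_i)_{i\ge 1}$ be a Poisson process with rate $1$, i.e. $T_1,T_2-T_1,T_3-T_2,\ldots$ are i.i.d. $\mathrm{Exp}(1)$, where $X$, $(Z_i)_i$ and $(T_i)_i$ are mutually independent. Let $r:\mathcal X\times\mathcal Z\to[0,\infty]$ be measurable such that, almost surely, $r(X,\cdot)$ is a version of the Radon–Nikodym derivative $\frac{\mathrm dP_{Z|X}(\cdot|X)}{\mathrm dQ}$. Put $\tilde T_i:=T_i\cdot r(X,Z_i)^{-1}$, with $\tilde T_i:=\infty$ if $r(X,Z_i)=0$. The Poisson private representation (PPR) with parameter $\alpha$ draws an index $K\in\{1,2,\ldots\}$ with $$\Pr\big(K=k\,\big|\,X,(Z_i)_i,(T_i)_i\big)=\frac{\tilde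 T_k^{-\alpha}}{\sum_{i=1}^\infty\tilde T_i^{-\alpha}}\quad\text{if }\alpha<\infty,\qquad K=\operatorname{argmin}_i\tilde T_i\quad\text{if }\alpha=\infty,$$ and outputs $Z_K$. Then PPR is almost surely well defined (the above selection probabilities almost surely sum to $1$; for $\alpha=\infty$, almost surely there is a unique minimizer), and for every index $K$ drawn in this way the conditional distribution of the output $Z_K$ given $X$ is exactly $P_{Z|X}$, i.e. $(X,Z_K)\sim P_X\otimes P_{Z|X}$. In particular, if the input is a fixed $x$ (that is, $X=x$ almost surely), then $Z_K\sim P_{Z|X}(\cdot|x)$. -/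

import Mathlib

open MeasureTheory ProbabilityTheory
open scoped ENNReal

/-- The inter-arrival times `T₁, T₂ - T₁, T₃ - T₂, …` of a sequence of random times.
Sequences are indexed by `ℕ` from `0`, so that index `i` here stands for index `i + 1 ∈ ℤ₊`. -/
def interarrival {Ω : Type*} (T : ℕ → Ω → ℝ) : ℕ → Ω → ℝ
  | 0 => T 0
  | i + 1 => fun ω => T (i + 1) ω - T i ω

/-- `T` is the sequence of points of a Poisson process of rate `1` on `[0, ∞)`:
the inter-arrival times are i.i.d. `Exp(1)`. -/
structure IsUnitPoissonProcess {Ω : Type*} [MeasurableSpace Ω] (μ : Measure Ω)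
    (T : ℕ → Ω → ℝ) : Prop where
  measurable : ∀ i, Measurable (T i)
  iIndepFun_interarrival : iIndepFun (interarrival T) μ
  hasLaw_interarrival : ∀ i, HasLaw (interarrival T i) (expMeasure 1) μ

/-- The randomness that enters the Poisson private representation before the index is drawn:
the input `X`, the shared samples `Z i`, i.i.d. with law `Q`, and the Poisson process `T` of rate `1`
generated by the encoder; `X`, `(Z i)ᵢ` and `(T i)ᵢ` are mutually independent. -/
structure IsPPRSource {Ω 𝒳 𝒵 : Type*} [MeasurableSpace Ω] [MeasurableSpace 𝒳] [MeasurableSpace 𝒵]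
    (μ : Measure Ω) (Q : Measure 𝒵) (X : Ω → 𝒳) (Z : ℕ → Ω → 𝒵) (T : ℕ → Ω → ℝ) : Prop where
  measurable_input : Measurable X
  measurable_sample : ∀ i, Measurable (Z i)
  iIndepFun_sample : iIndepFun Z μ
  hasLaw_sample : ∀ i, HasLaw (Z i) Q μ
  poisson : IsUnitPoissonProcess μ T
  indepFun_sample_times : IndepFun (fun ω i => Z i ω) (fun ω i => T i ω) μ
  indepFun_input : IndepFun X (fun ω => ((fun i => Z i ω : ℕ → 𝒵), (fun i => T i ω : ℕ → ℝ))) μ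

open Classical in
/-- `T̃ᵢ = Tᵢ · (f(zᵢ))⁻¹`, with `T̃ᵢ = ∞` if `f(zᵢ) = 0`, for a density `f`. -/
noncomputable def tiltedTime {𝒵 : Type*} (f : 𝒵 → ℝ≥0∞) (z : ℕ → 𝒵) (t : ℕ → ℝ) (i : ℕ) : ℝ≥0∞ :=
  if f (z i) = 0 then ∞ else ENNReal.ofReal (t i) * (f (z i))⁻¹

open Classical in
/-- The selection probabilities of the Poisson private representation with parameter `α`, given
the sequence `s` of tilted times: `s_k ^ (-α) / ∑ᵢ s_i ^ (-α)` if `α < ∞`, and the indicator of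
`k = argminᵢ s_i` if `α = ∞`. -/
noncomputable def pprProb (α : ℝ≥0∞) (s : ℕ → ℝ≥0∞) (k : ℕ) : ℝ≥0∞ :=
  if α = ∞ then (if ∀ i, s k ≤ s i then 1 else 0)
  else s k ^ (-α.toReal) / ∑' i, s i ^ (-α.toReal)

/-- `K` is an index generated by the encoder of the Poisson private representation: conditionally
on the input `X`, the samples `(Z i)ᵢ` and the times `(T i)ᵢ`, it equals `k` with the
probability `pprProb α T̃ k`, where `T̃ᵢ = Tᵢ · (r(X, Zᵢ))⁻¹`. -/
structure IsPPRIndex {Ω 𝒳 𝒵 : Type*} [MeasurableSpace Ω] [MeasurableSpace 𝒳] [MeasurableSpace 𝒵]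
    (μ : Measure Ω) (α : ℝ≥0∞) (r : 𝒳 → 𝒵 → ℝ≥0∞)
    (X : Ω → 𝒳) (Z : ℕ → Ω → 𝒵) (T : ℕ → Ω → ℝ) (K : Ω → ℕ) : Prop where
  measurable : Measurable K
  condProb : ∀ k,
    μ⟦K ⁻¹' {k} | MeasurableSpace.comap
        (fun ω => (X ω, (fun i => Z i ω : ℕ → 𝒵), (fun i => T i ω : ℕ → ℝ))) inferInstance⟧
      =ᵐ[μ] fun ω =>
        (pprProb α (tiltedTime (r (X ω)) (fun i => Z i ω) (fun i => T i ω)) k).toReal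

/-! Fix the input and let `f` be its density with respect to `Q`. The samples with finite tilted
time, each paired with that time, form a Poisson process of intensity `f • Q ⊗ volume` on `(0, ∞)`.
By the Mecke formula (`tsum_lintegral_tiltedTime_skipAt`), summing a function of a point and of the
remaining times over all points amounts to integrating over an extra point `(a, s)`, with weight `f
a`, added to an unchanged copy of the process. The selection probability of a point depends on its
own time and on the other times, but not on its mark (`pprProb_eq_seqCons`). Hence the output lies
in `A` with probability `(∫⁻ a in A, f a ∂Q) * C`, with `C` independent of `A`. Since the selection
probabilities sum to `1` (`ae_tsum_pprProb`), taking `A = Set.univ` gives `C = 1`; no explicit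
evaluation of `C` is needed.

The Mecke formula comes from the exponential gaps. Deleting the `k`-th point merges two gaps into
one of length `c`, over which the deleted point is spread by Lebesgue measure
(`lintegral_gapLaw_mergeAt`); summed over `k`, these gaps tile `(0, ∞)`. Marks are carried along
because an i.i.d. sequence stays i.i.d. when a term is removed, and the substitution `u = f a * s`
produces the density.

The same formula shows that the selection is well defined: finitely many tilted times are bounded by
`n`, their powers are summable, and finite times have no ties. Independence and Fubini then reduce a
random input to a fixed one. -/

/-! ### I.i.d. sequences: prepending and removing a term. -/

/-- Prepend a term to a sequence. -/
def seqCons {β : Type*} (a : β) (s : ℕ → β) : ℕ → β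
  | 0 => a
  | i + 1 => s i

@[simp] lemma seqCons_zero {β : Type*} (a : β) (s : ℕ → β) : seqCons a s 0 = a := rfl

@[simp] lemma seqCons_succ {β : Type*} (a : β) (s : ℕ → β) (i : ℕ) :
    seqCons a s (i + 1) = s i := rfl

@[fun_prop]
lemma Measurable.seqCons {γ β : Type*} [MeasurableSpace γ] [MeasurableSpace β] {f : γ → β}
    {g : γ → ℕ → β} (hf : Measurable f) (hg : Measurable g) :
    Measurable fun c => seqCons (f c) (g c) := by
  refine measurable_pi_iff.2 fun i => ?_
  cases i with
  | zero => exact hf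
  | succ i => exact (measurable_pi_apply i).comp hg

/-- The increasing enumeration of `ℕ \ {k}`. -/
def skipAt (k i : ℕ) : ℕ := if i < k then i else i + 1

lemma tsum_eq_add_tsum_skipAt (w : ℕ → ℝ≥0∞) (k : ℕ) :
    ∑' i, w i = w k + ∑' i, w (skipAt k i) := by
  rw [← ENNReal.summable.sum_add_tsum_nat_add' (f := w) (k := k + 1),
    ← ENNReal.summable.sum_add_tsum_nat_add' (f := fun i => w (skipAt k i)) (k := k),
    Finset.sum_range_succ, add_comm _ (w k), add_assoc]
  congr 2
  · exact Finset.sum_congr rfl fun i hi => by simp [skipAt, Finset.mem_range.1 hi]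
  · exact tsum_congr fun i => by simp [skipAt]; ring_nf

lemma exists_skipAt_eq {k j : ℕ} (h : j ≠ k) : ∃ i, skipAt k i = j := by
  rcases lt_or_gt_of_ne h with h | h
  · exact ⟨j, by simp [skipAt, h]⟩
  · exact ⟨j - 1, by unfold skipAt; split_ifs <;> omega⟩

/-- A sequence of i.i.d. variables is an independent first term followed by a copy of itself. -/
lemma map_seqCons_infinitePi {β : Type*} [MeasurableSpace β] (m : Measure β)
    [IsProbabilityMeasure m] :
    (m.prod (Measure.infinitePi fun _ : ℕ => m)).map (fun p => seqCons p.1 p.2)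
      = Measure.infinitePi fun _ : ℕ => m := by
  classical
  refine Measure.eq_infinitePi _ fun s t ht => ?_
  -- Padding the cylinder with `Set.univ` makes it depend on an initial segment, whose preimage
  -- under prepending is a rectangle.
  obtain ⟨n, hn⟩ : ∃ n, s ⊆ Finset.range (n + 1) :=
    ⟨s.sup id, fun i hi => Finset.mem_range_succ_iff.2 (Finset.le_sup (f := id) hi)⟩
  set t' : ℕ → Set β := fun i => if i ∈ s then t i else Set.univ with ht'
  have hmt' : ∀ i, MeasurableSet (t' i) := fun i => by
    simp only [ht']; split_ifs
    exacts [ht i, .univ]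
  have hpi : Set.pi s t = Set.pi (Finset.range (n + 1)) t' := by
    ext x
    simp only [Set.mem_pi, Finset.mem_coe, ht']
    refine ⟨fun h i _ => ?_, fun h i hi => ?_⟩
    · split_ifs with his
      exacts [h i his, trivial]
    · simpa [hi] using h i (hn hi)
  have hprod : ∏ i ∈ s, m (t i) = ∏ i ∈ Finset.range (n + 1), m (t' i) := by
    rw [← Finset.prod_subset hn]
    · exact Finset.prod_congr rfl fun i hi => by simp [ht', hi]
    · intro i _ hi
      simp [ht', hi]
  have hpre : (fun p : β × (ℕ → β) => seqCons p.1 p.2) ⁻¹' Set.pi (Finset.range (n + 1)) t'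
      = t' 0 ×ˢ Set.pi (Finset.range n) (fun i => t' (i + 1)) := by
    ext p
    simp only [Set.mem_preimage, Set.mem_pi, Finset.mem_coe, Finset.mem_range, Set.mem_prod]
    refine ⟨fun h => ⟨h 0 n.succ_pos, fun i hi => h (i + 1) (by omega)⟩, fun h i hi => ?_⟩
    cases i with
    | zero => exact h.1
    | succ i => exact h.2 i (by omega)
  rw [hpi, hprod, Measure.map_apply (by fun_prop)
    (.pi (Finset.countable_toSet _) fun i _ => hmt' i), hpre, Measure.prod_prod,
    Measure.infinitePi_pi _ (fun i _ => hmt' (i + 1)), Finset.prod_range_succ', mul_comm]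

lemma lintegral_infinitePi_eq_seqCons {β : Type*} [MeasurableSpace β] (m : Measure β)
    [IsProbabilityMeasure m] {φ : (ℕ → β) → ℝ≥0∞} (hφ : Measurable φ) :
    ∫⁻ s, φ s ∂Measure.infinitePi (fun _ : ℕ => m)
      = ∫⁻ a, ∫⁻ s, φ (seqCons a s) ∂Measure.infinitePi (fun _ : ℕ => m) ∂m := by
  conv_lhs => rw [← map_seqCons_infinitePi m]
  rw [lintegral_map hφ (by fun_prop), lintegral_prod _ (by fun_prop)]

/-- Removing a term from an i.i.d. sequence leaves an independent copy of the sequence. -/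
lemma lintegral_infinitePi_skipAt {β : Type*} [MeasurableSpace β] (m : Measure β)
    [IsProbabilityMeasure m] (k : ℕ) {G : β → (ℕ → β) → ℝ≥0∞}
    (hG : Measurable (Function.uncurry G)) :
    ∫⁻ s, G (s k) (fun i => s (skipAt k i)) ∂Measure.infinitePi (fun _ : ℕ => m)
      = ∫⁻ a, ∫⁻ s, G a s ∂Measure.infinitePi (fun _ : ℕ => m) ∂m := by
  induction k generalizing G with
  | zero =>
    rw [lintegral_infinitePi_eq_seqCons m (by fun_prop)]
    simp [skipAt]
  | succ k ih =>
    have hskip : ∀ a (s : ℕ → β), (fun i => seqCons a s (skipAt (k + 1) i))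
        = seqCons a (fun i => s (skipAt k i)) := by
      intro a s
      funext i
      cases i with
      | zero => simp [skipAt]
      | succ i => by_cases h : i < k <;> simp [skipAt, h]
    rw [lintegral_infinitePi_eq_seqCons m (by fun_prop)]
    simp only [seqCons_succ, hskip]
    have : ∀ a, ∫⁻ s, G (s k) (seqCons a fun i => s (skipAt k i))
        ∂Measure.infinitePi (fun _ : ℕ => m)
        = ∫⁻ b, ∫⁻ s, G b (seqCons a s) ∂Measure.infinitePi (fun _ : ℕ => m) ∂m :=
      fun a => ih (G := fun b s => G b (seqCons a s)) (by fun_prop)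
    simp only [this]
    -- Here `b` is the removed term and `a` heads the remaining sequence; once `b` is outermost, `a`
    -- is absorbed back into an i.i.d. sequence.
    rw [lintegral_lintegral_swap (by fun_prop)]
    refine lintegral_congr fun b => ?_
    rw [lintegral_infinitePi_eq_seqCons m (by fun_prop)]

/-! ### Exponential gaps and their splitting. -/

instance : IsProbabilityMeasure (expMeasure 1) := isProbabilityMeasure_expMeasure one_pos

/-- The law of the inter-arrival times of a Poisson process of rate `1`. -/
noncomputable def gapLaw : Measure (ℕ → ℝ) := Measure.infinitePi fun _ => expMeasure 1

instance : IsProbabilityMeasure gapLaw :=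
  inferInstanceAs (IsProbabilityMeasure (Measure.infinitePi _))

lemma measurable_exponentialPDF : Measurable (exponentialPDF 1) :=
  (measurable_exponentialPDFReal 1).ennreal_ofReal

lemma lintegral_expMeasure {g : ℝ → ℝ≥0∞} (hg : Measurable g) :
    ∫⁻ x, g x ∂expMeasure 1 = ∫⁻ x, exponentialPDF 1 x * g x :=
  lintegral_withDensity_eq_lintegral_mul _ measurable_exponentialPDF hg

lemma lintegral_gapLaw_eq_seqCons {φ : (ℕ → ℝ) → ℝ≥0∞} (hφ : Measurable φ) :
    ∫⁻ e, φ e ∂gapLaw = ∫⁻ a, ∫⁻ e, φ (seqCons a e) ∂gapLaw ∂expMeasure 1 :=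
  lintegral_infinitePi_eq_seqCons _ hφ

/-- The indicator function of `0 ≤ u ≤ c`. -/
noncomputable def gapIndicator (c u : ℝ) : ℝ≥0∞ := (Set.Icc 0 c).indicator 1 u

lemma measurable_uncurry_gapIndicator : Measurable (Function.uncurry gapIndicator) := by
  refine (measurable_const (a := (1 : ℝ≥0∞))).indicator
    (s := {p : ℝ × ℝ | p.2 ∈ Set.Icc 0 p.1}) ?_
  simp only [Set.mem_Icc]
  measurability

@[fun_prop]
lemma Measurable.gapIndicator {γ : Type*} [MeasurableSpace γ] {f g : γ → ℝ} (hf : Measurable f)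
    (hg : Measurable g) : Measurable fun c => gapIndicator (f c) (g c) :=
  measurable_uncurry_gapIndicator.comp (hf.prodMk hg)

/-- Since `exp (-a) * exp (-(c - a)) = exp (-c)`, the position `a` of a point inside a merged gap of
length `c` has constant density on `[0, c]`. -/
lemma exponentialPDF_mul_sub (a c : ℝ) :
    exponentialPDF 1 a * exponentialPDF 1 (c - a) = exponentialPDF 1 c * gapIndicator c a := by
  unfold gapIndicator
  by_cases ha : 0 ≤ a
  · by_cases hc : a ≤ c
    · rw [exponentialPDF_of_nonneg ha, exponentialPDF_of_nonneg (sub_nonneg.2 hc),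
        exponentialPDF_of_nonneg (ha.trans hc), ← ENNReal.ofReal_mul (by positivity)]
      simp only [one_mul, ← Real.exp_add, Set.mem_Icc, ha, hc, and_self, Set.indicator_of_mem,
        Pi.one_apply, mul_one]
      ring_nf
    · rw [exponentialPDF_of_neg (sub_neg.2 (not_le.1 hc))]
      simp [hc]
  · rw [exponentialPDF_of_neg (not_le.1 ha)]
    simp [ha]

/-- The sequence of gaps that is left when the `k`-th point of a point process is removed. -/
def mergeAt (k : ℕ) (e : ℕ → ℝ) (i : ℕ) : ℝ :=
  if i < k then e i else if i = k then e k + e (k + 1) else e (i + 1)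

@[fun_prop]
lemma measurable_mergeAt (k : ℕ) : Measurable (mergeAt k) := by
  refine measurable_pi_iff.2 fun i => ?_
  unfold mergeAt
  split_ifs <;> fun_prop

lemma mergeAt_succ_seqCons (k : ℕ) (a : ℝ) (e : ℕ → ℝ) :
    mergeAt (k + 1) (seqCons a e) = seqCons a (mergeAt k e) := by
  funext i
  cases i with
  | zero => simp [mergeAt]
  | succ i => simp [mergeAt]

/-- Splitting a gap: the gap before the `k`-th point and the remaining process, in terms of the
uniform measure on the `k`-th gap. -/
lemma lintegral_gapLaw_mergeAt (k : ℕ) {φ : ℝ → (ℕ → ℝ) → ℝ≥0∞}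
    (hφ : Measurable (Function.uncurry φ)) :
    ∫⁻ e, φ (e k) (mergeAt k e) ∂gapLaw
      = ∫⁻ e, ∫⁻ u : ℝ, gapIndicator (e k) u * φ u e ∂volume ∂gapLaw := by
  have hp := measurable_exponentialPDF
  induction k generalizing φ with
  | zero =>
    have h0 : ∀ a b (e : ℕ → ℝ), mergeAt 0 (seqCons a (seqCons b e)) = seqCons (a + b) e := by
      intro a b e
      funext i
      cases i <;> simp [mergeAt]
    have hG : Measurable fun p : ℝ × ℝ => ∫⁻ e, φ p.1 (seqCons p.2 e) ∂gapLaw :=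
      Measurable.lintegral_prod_right' (f := fun q : (ℝ × ℝ) × (ℕ → ℝ) =>
        φ q.1.1 (seqCons q.1.2 q.2)) (by fun_prop)
    calc ∫⁻ e, φ (e 0) (mergeAt 0 e) ∂gapLaw
        = ∫⁻ a, ∫⁻ b, ∫⁻ e, φ a (seqCons (a + b) e) ∂gapLaw ∂expMeasure 1 ∂expMeasure 1 := by
          rw [lintegral_gapLaw_eq_seqCons (by fun_prop)]
          refine lintegral_congr fun a => ?_
          rw [lintegral_gapLaw_eq_seqCons (by fun_prop)]
          simp only [h0, seqCons_zero]
      _ = ∫⁻ a, ∫⁻ c, exponentialPDF 1 c * gapIndicator c a *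
            ∫⁻ e, φ a (seqCons c e) ∂gapLaw := by
          rw [lintegral_expMeasure (by fun_prop)]
          refine lintegral_congr fun a => ?_
          -- Translation by `-a` replaces the second gap `b` by the merged gap `c = a + b`.
          rw [lintegral_expMeasure (by fun_prop), ← lintegral_const_mul _ (by fun_prop),
            ← lintegral_add_left_eq_self _ (-a)]
          refine lintegral_congr fun c => ?_
          rw [← mul_assoc, neg_add_eq_sub, exponentialPDF_mul_sub, add_sub_cancel]
      _ = ∫⁻ c, ∫⁻ a, exponentialPDF 1 c * gapIndicator c a *
            ∫⁻ e, φ a (seqCons c e) ∂gapLaw := by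
          refine lintegral_lintegral_swap (Measurable.aemeasurable ?_)
          exact Measurable.mul (by fun_prop) hG
      _ = ∫⁻ c, ∫⁻ e, ∫⁻ u : ℝ, gapIndicator c u * φ u (seqCons c e) ∂volume ∂gapLaw ∂expMeasure 1 := by
          rw [lintegral_expMeasure (by fun_prop)]
          refine lintegral_congr fun c => ?_
          simp only [mul_assoc]
          rw [lintegral_const_mul _ (by fun_prop), lintegral_lintegral_swap (by fun_prop)]
          congr 1
          refine lintegral_congr fun a => ?_
          rw [lintegral_const_mul _ (by fun_prop)]
      _ = _ := by
          rw [lintegral_gapLaw_eq_seqCons (by fun_prop)]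
          rfl
  | succ k ih =>
    rw [lintegral_gapLaw_eq_seqCons (by fun_prop), lintegral_gapLaw_eq_seqCons (by fun_prop)]
    refine lintegral_congr fun a => ?_
    simp only [seqCons_succ, mergeAt_succ_seqCons]
    exact ih (φ := fun u e => φ u (seqCons a e)) (by fun_prop)

/-! ### Arrival times: deletion of a point, positivity and divergence. -/

/-- The arrival times of a point process with given gaps. -/
def arrival (e : ℕ → ℝ) (i : ℕ) : ℝ := ∑ j ∈ Finset.range (i + 1), e j

@[fun_prop]
lemma measurable_arrival : Measurable arrival := by
  refine measurable_pi_iff.2 fun i => ?_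
  unfold arrival
  fun_prop

lemma sum_range_mergeAt_of_le {k n : ℕ} (h : n ≤ k) (e : ℕ → ℝ) :
    ∑ j ∈ Finset.range n, mergeAt k e j = ∑ j ∈ Finset.range n, e j :=
  Finset.sum_congr rfl fun j hj => by
    simp [mergeAt, (Finset.mem_range.1 hj).trans_le h]

/-- Adding gap `k + 1` to gap `k` erases the point between them and moves no other point. -/
lemma arrival_mergeAt (k : ℕ) (e : ℕ → ℝ) :
    arrival (mergeAt k e) = fun i => arrival e (skipAt k i) := by
  funext i
  rcases lt_or_ge i k with h | h
  · simp only [arrival, skipAt, if_pos h]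
    exact sum_range_mergeAt_of_le h e
  · induction i, h using Nat.le_induction with
    | base =>
      simp only [arrival, skipAt, lt_irrefl, if_false, Finset.sum_range_succ]
      rw [sum_range_mergeAt_of_le le_rfl]
      simp [mergeAt, add_assoc]
    | succ i hi ih =>
      have h1 : skipAt k (i + 1) = skipAt k i + 1 := by unfold skipAt; split_ifs <;> omega
      have h2 : skipAt k i = i + 1 := by simp [skipAt, hi]
      rw [h1]
      unfold arrival at ih ⊢
      rw [Finset.sum_range_succ, ih, Finset.sum_range_succ _ (skipAt k i + 1), h2]
      simp [mergeAt, show ¬ i + 1 < k by omega, show i + 1 ≠ k by omega]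

lemma ae_expMeasure_pos : ∀ᵐ x ∂expMeasure 1, 0 < x := by
  have hind : Measurable ((Set.Iic (0 : ℝ)).indicator (1 : ℝ → ℝ≥0∞)) :=
    measurable_one.indicator measurableSet_Iic
  rw [ae_iff]
  simp only [not_lt]
  change expMeasure 1 (Set.Iic 0) = 0
  rw [← lintegral_indicator_one measurableSet_Iic, lintegral_expMeasure hind]
  refine (lintegral_congr_ae ?_).trans lintegral_zero
  filter_upwards [Measure.ae_ne volume (0 : ℝ)] with x hx
  rcases lt_or_gt_of_ne hx with h | h
  · simp [exponentialPDF_of_neg h]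
  · simp [h]

lemma ae_gapLaw_pos : ∀ᵐ e ∂gapLaw, ∀ i, 0 < e i :=
  ae_all_iff.2 fun i => (measurePreserving_eval_infinitePi
    (fun _ : ℕ => expMeasure 1) i).quasiMeasurePreserving.ae ae_expMeasure_pos

lemma lintegral_exp_neg_lt_one : ∫⁻ x, ENNReal.ofReal (Real.exp (-x)) ∂expMeasure 1 < 1 := by
  have hlt : ∀ᵐ x ∂expMeasure 1, ENNReal.ofReal (Real.exp (-x)) < 1 := by
    filter_upwards [ae_expMeasure_pos] with x hx
    simpa using hx
  have h1 : ∫⁻ _, (1 : ℝ≥0∞) ∂expMeasure 1 = 1 := by simp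
  have hfin := ne_top_of_le_ne_top (h1.trans_ne ENNReal.one_ne_top)
    (lintegral_mono_ae (hlt.mono fun _ h => h.le))
  exact (lintegral_strict_mono (IsProbabilityMeasure.ne_zero _) aemeasurable_const hfin
    hlt).trans_eq h1

/-- The arrival times are almost surely unbounded. -/
lemma ae_gapLaw_unbounded : ∀ᵐ e ∂gapLaw, ∀ t : ℝ, ∃ n, t < ∑ j ∈ Finset.range n, e j := by
  -- `g` vanishes exactly when the arrival times are unbounded. Peeling off the first gap bounds the
  -- mean of `g` by itself times a factor below `1`, so this mean, being finite, is `0`.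
  set g : (ℕ → ℝ) → ℝ≥0∞ := fun e =>
    ⨅ n, ENNReal.ofReal (Real.exp (-∑ j ∈ Finset.range (n + 1), e j)) with hg
  have hgm : Measurable g := by fun_prop
  have hcons : ∀ a e, g (seqCons a e) ≤ ENNReal.ofReal (Real.exp (-a)) * g e := by
    intro a e
    simp only [hg]
    rw [ENNReal.mul_iInf_of_ne (by simp [Real.exp_pos]) (by simp)]
    refine le_iInf fun n => (iInf_le _ (n + 1)).trans_eq ?_
    rw [← ENNReal.ofReal_mul (by positivity), ← Real.exp_add, Finset.sum_range_succ']
    simp [add_comm]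
  have hle : ∀ᵐ e ∂gapLaw, g e ≤ 1 := by
    filter_upwards [ae_gapLaw_pos] with e he
    refine (iInf_le _ 0).trans ?_
    simpa using (he 0).le
  have hfin : ∫⁻ e, g e ∂gapLaw ≠ ∞ := by
    refine ne_top_of_le_ne_top ENNReal.one_ne_top ((lintegral_mono_ae hle).trans ?_)
    simp
  have hzero : ∫⁻ e, g e ∂gapLaw = 0 := by
    by_contra h0
    have : ∫⁻ e, g e ∂gapLaw
        ≤ (∫⁻ x, ENNReal.ofReal (Real.exp (-x)) ∂expMeasure 1) * ∫⁻ e, g e ∂gapLaw := by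
      conv_lhs => rw [lintegral_gapLaw_eq_seqCons hgm]
      rw [← lintegral_mul_const _ (by fun_prop)]
      refine lintegral_mono fun a => ?_
      rw [← lintegral_const_mul _ hgm]
      exact lintegral_mono fun e => hcons a e
    have hlt := ENNReal.mul_lt_mul_left h0 hfin lintegral_exp_neg_lt_one
    rw [one_mul] at hlt
    exact absurd this (not_le.2 hlt)
  rw [lintegral_eq_zero_iff hgm] at hzero
  filter_upwards [hzero] with e he t
  have : g e < ENNReal.ofReal (Real.exp (-t)) := by
    rw [he]; simp [Real.exp_pos]
  obtain ⟨n, hn⟩ := iInf_lt_iff.1 this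
  rw [ENNReal.ofReal_lt_ofReal_iff (Real.exp_pos _), Real.exp_lt_exp] at hn
  exact ⟨n + 1, by linarith⟩

/-- Positive gaps with unbounded partial sums tile `(0, ∞)` by consecutive half-open intervals; each
integral over a gap is translated to its place. -/
lemma tsum_lintegral_gap {e : ℕ → ℝ} (hpos : ∀ i, 0 < e i)
    (hunb : ∀ t : ℝ, ∃ n, t < ∑ j ∈ Finset.range n, e j) {g : ℝ → ℝ≥0∞} :
    ∑' k, ∫⁻ u : ℝ, gapIndicator (e k) u * g (∑ j ∈ Finset.range k, e j + u)
      = ∫⁻ u in Set.Ioi 0, g u := by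
  set S : ℕ → ℝ := fun k => ∑ j ∈ Finset.range k, e j with hS
  have hSs : ∀ k, S (k + 1) = S k + e k := fun k => Finset.sum_range_succ _ _
  have hmono : Monotone S := monotone_nat_of_le_succ fun k => by
    rw [hSs]; linarith [hpos k]
  have hset : Set.Ioi (0 : ℝ) = ⋃ k, Set.Ioc (S k) (S (k + 1)) := by
    ext t
    simp only [Set.mem_Ioi, Set.mem_iUnion, Set.mem_Ioc]
    constructor
    · intro ht
      classical
      have hex : ∃ n, t ≤ S n := (hunb t).imp fun n hn => hn.le
      obtain ⟨m, hm⟩ : ∃ m, Nat.find hex = m + 1 := Nat.exists_eq_succ_of_ne_zero fun h => by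
        have := Nat.find_spec hex
        rw [h] at this
        simp [hS] at this
        linarith
      refine ⟨m, not_le.1 (Nat.find_min hex (by omega)), ?_⟩
      rw [← hm]
      exact Nat.find_spec hex
    · rintro ⟨k, hk, -⟩
      have h0 : S 0 = 0 := by simp [hS]
      have := hmono (Nat.zero_le k)
      linarith
  rw [hset, lintegral_iUnion (fun _ => measurableSet_Ioc)
    (by simpa using hmono.pairwise_disjoint_on_Ioc_succ)]
  refine tsum_congr fun k => ?_
  rw [restrict_Ioc_eq_restrict_Icc, ← lintegral_indicator measurableSet_Icc,
    ← lintegral_add_left_eq_self ((Set.Icc (S k) (S (k + 1))).indicator g) (S k)]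
  refine lintegral_congr fun u => ?_
  simp only [gapIndicator, Set.indicator, Set.mem_Icc, hSs]
  by_cases h : 0 ≤ u ∧ u ≤ e k <;> simp [h, hS]

/-! ### The Mecke formula, without and with marks. -/

/-- The law of the sequence of points of a Poisson process of rate `1`. -/
noncomputable def poissonLaw : Measure (ℕ → ℝ) := gapLaw.map arrival

instance : IsProbabilityMeasure poissonLaw :=
  Measure.isProbabilityMeasure_map measurable_arrival.aemeasurable

lemma ae_poissonLaw_pos : ∀ᵐ t ∂poissonLaw, ∀ i, 0 < t i := by
  rw [poissonLaw, ae_map_iff measurable_arrival.aemeasurable (by measurability)]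
  filter_upwards [ae_gapLaw_pos] with e he i
  exact Finset.sum_pos (fun j _ => he j) ⟨0, by simp⟩

/-- The Mecke formula for the Poisson process of rate `1`. -/
lemma tsum_lintegral_poissonLaw_skipAt {F : ℝ → (ℕ → ℝ) → ℝ≥0∞}
    (hF : Measurable (Function.uncurry F)) :
    ∑' k, ∫⁻ t, F (t k) (fun i => t (skipAt k i)) ∂poissonLaw
      = ∫⁻ u in Set.Ioi 0, ∫⁻ t, F u t ∂poissonLaw := by
  have h1 : ∀ k, ∫⁻ t, F (t k) (fun i => t (skipAt k i)) ∂poissonLaw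
      = ∫⁻ e, ∫⁻ u : ℝ, gapIndicator (e k) u *
          F (∑ j ∈ Finset.range k, e j + u) (arrival e) ∂volume ∂gapLaw := by
    intro k
    -- The gaps before index `k` survive the merging, so the `k`-th point can be recovered as their
    -- sum plus `u`.
    rw [← lintegral_gapLaw_mergeAt k
      (φ := fun u e => F (∑ j ∈ Finset.range k, e j + u) (arrival e)) (by fun_prop),
      poissonLaw, lintegral_map (by fun_prop) measurable_arrival]
    refine lintegral_congr fun e => ?_
    simp only [arrival_mergeAt, sum_range_mergeAt_of_le le_rfl]
    rw [← Finset.sum_range_succ]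
    rfl
  simp only [h1]
  rw [← lintegral_tsum (fun k => by fun_prop)]
  have h2 : ∀ᵐ e ∂gapLaw, ∑' k, ∫⁻ u : ℝ, gapIndicator (e k) u *
        F (∑ j ∈ Finset.range k, e j + u) (arrival e)
      = ∫⁻ u in Set.Ioi 0, F u (arrival e) := by
    filter_upwards [ae_gapLaw_pos, ae_gapLaw_unbounded] with e hpos hunb
    exact tsum_lintegral_gap hpos hunb (g := fun u => F u (arrival e))
  rw [lintegral_congr_ae h2, lintegral_lintegral_swap (by fun_prop)]
  refine lintegral_congr fun u => ?_
  rw [poissonLaw, lintegral_map (by fun_prop) measurable_arrival]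

/-- The joint law of i.i.d. samples from `Q` and an independent Poisson process of rate `1`. -/
noncomputable def sourceLaw {𝒵 : Type*} [MeasurableSpace 𝒵] (Q : Measure 𝒵) :
    Measure ((ℕ → 𝒵) × (ℕ → ℝ)) :=
  (Measure.infinitePi fun _ => Q).prod poissonLaw

instance {𝒵 : Type*} [MeasurableSpace 𝒵] (Q : Measure 𝒵) [IsProbabilityMeasure Q] :
    IsProbabilityMeasure (sourceLaw Q) :=
  inferInstanceAs (IsProbabilityMeasure ((Measure.infinitePi fun _ => Q).prod poissonLaw))

/-- The Mecke formula for a marked Poisson process of rate `1`. -/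
lemma tsum_lintegral_sourceLaw_skipAt {𝒵 : Type*} [MeasurableSpace 𝒵] (Q : Measure 𝒵)
    [IsProbabilityMeasure Q] {H : 𝒵 → ℝ → (ℕ → 𝒵) × (ℕ → ℝ) → ℝ≥0∞}
    (hH : Measurable fun q : 𝒵 × ℝ × (ℕ → 𝒵) × (ℕ → ℝ) => H q.1 q.2.1 q.2.2) :
    ∑' k, ∫⁻ p, H (p.1 k) (p.2 k) (fun i => p.1 (skipAt k i), fun i => p.2 (skipAt k i))
        ∂sourceLaw Q
      = ∫⁻ a, ∫⁻ u in Set.Ioi 0, ∫⁻ p, H a u p ∂sourceLaw Q ∂volume ∂Q := by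
  have hH' : ∀ {γ : Type _} [MeasurableSpace γ] {a : γ → 𝒵} {u : γ → ℝ} {z : γ → ℕ → 𝒵}
      {t : γ → ℕ → ℝ}, Measurable a → Measurable u → Measurable z → Measurable t →
      Measurable fun c => H (a c) (u c) (z c, t c) :=
    fun ha hu hz ht => hH.comp (ha.prodMk (hu.prodMk (hz.prodMk ht)))
  have h1 : ∀ k, ∫⁻ p, H (p.1 k) (p.2 k) (fun i => p.1 (skipAt k i), fun i => p.2 (skipAt k i))
        ∂sourceLaw Q
      = ∫⁻ a, ∫⁻ z, ∫⁻ t, H a (t k) (z, fun i => t (skipAt k i)) ∂poissonLaw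
          ∂(Measure.infinitePi fun _ : ℕ => Q) ∂Q := by
    intro k
    rw [sourceLaw, lintegral_prod _
      (hH' (by fun_prop) (by fun_prop) (by fun_prop) (by fun_prop)).aemeasurable]
    refine lintegral_infinitePi_skipAt Q k
      (G := fun a z => ∫⁻ t, H a (t k) (z, fun i => t (skipAt k i)) ∂poissonLaw) ?_
    refine Measurable.lintegral_prod_right' (f := fun q : (𝒵 × (ℕ → 𝒵)) × (ℕ → ℝ) =>
      H q.1.1 (q.2 k) (q.1.2, fun i => q.2 (skipAt k i))) ?_
    exact hH' (by fun_prop) (by fun_prop) (by fun_prop) (by fun_prop)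
  have hm2 : ∀ k, Measurable fun q : 𝒵 × (ℕ → 𝒵) =>
      ∫⁻ t, H q.1 (t k) (q.2, fun i => t (skipAt k i)) ∂poissonLaw := fun k =>
    Measurable.lintegral_prod_right' (f := fun q : (𝒵 × (ℕ → 𝒵)) × (ℕ → ℝ) =>
      H q.1.1 (q.2 k) (q.1.2, fun i => q.2 (skipAt k i)))
      (hH' (by fun_prop) (by fun_prop) (by fun_prop) (by fun_prop))
  simp only [h1]
  rw [← lintegral_tsum fun k => (hm2 k).lintegral_prod_right'.aemeasurable]
  refine lintegral_congr fun a => ?_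
  have hm3 : ∀ k, Measurable fun z : ℕ → 𝒵 =>
      ∫⁻ t, H a (t k) (z, fun i => t (skipAt k i)) ∂poissonLaw := fun k =>
    (hm2 k).comp measurable_prodMk_left
  refine (lintegral_tsum fun k => (hm3 k).aemeasurable).symm.trans ?_
  have h3 : ∀ z : ℕ → 𝒵, ∑' k, ∫⁻ t, H a (t k) (z, fun i => t (skipAt k i)) ∂poissonLaw
      = ∫⁻ u in Set.Ioi 0, ∫⁻ t, H a u (z, t) ∂poissonLaw := fun z =>
    tsum_lintegral_poissonLaw_skipAt (F := fun u t => H a u (z, t))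
      (hH.comp (by fun_prop : Measurable fun q : ℝ × (ℕ → ℝ) => (a, q.1, z, q.2)))
  simp only [h3]
  rw [lintegral_lintegral_swap]
  · refine lintegral_congr fun u => ?_
    rw [sourceLaw, lintegral_prod _
      (hH' (by fun_prop) (by fun_prop) (by fun_prop) (by fun_prop)).aemeasurable]
  · exact (Measurable.lintegral_prod_right' (f := fun q : ((ℕ → 𝒵) × ℝ) × (ℕ → ℝ) =>
      H a q.1.2 (q.1.1, q.2))
      (hH' (by fun_prop) (by fun_prop) (by fun_prop) (by fun_prop))).aemeasurable

/-! ### Tilted times and their Mecke formula. -/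

lemma Measurable.tiltedTime {γ 𝒵 : Type*} [MeasurableSpace γ] [MeasurableSpace 𝒵]
    {f : γ → 𝒵 → ℝ≥0∞} {z : γ → ℕ → 𝒵} {t : γ → ℕ → ℝ}
    (hf : Measurable (Function.uncurry f)) (hz : Measurable z) (ht : Measurable t) :
    Measurable fun c => tiltedTime (f c) (z c) (t c) := by
  refine measurable_pi_iff.2 fun i => ?_
  have hfz : Measurable fun c => f c (z c i) :=
    hf.comp (measurable_id.prodMk ((measurable_pi_apply i).comp hz))
  unfold _root_.tiltedTime
  exact Measurable.ite (hfz (measurableSet_singleton 0)) measurable_const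
    (((measurable_pi_apply i).comp ht).ennreal_ofReal.mul hfz.inv)

lemma measurable_pprProb (α : ℝ≥0∞) (k : ℕ) : Measurable fun s => pprProb α s k := by
  unfold pprProb
  split_ifs with h
  · refine Measurable.ite ?_ measurable_const measurable_const
    simp only [Set.ofPred_forall]
    exact .iInter fun i => measurableSet_le (by fun_prop) (by fun_prop)
  · fun_prop

lemma lintegral_Ioi_mul_inv {φ : ℝ≥0∞ → ℝ≥0∞} (hφ : Measurable φ) {c : ℝ≥0∞} (h0 : c ≠ 0)
    (htop : c ≠ ∞) :
    ∫⁻ u in Set.Ioi (0 : ℝ), φ (ENNReal.ofReal u * c⁻¹)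
      = c * ∫⁻ s in Set.Ioi (0 : ℝ), φ (ENNReal.ofReal s) := by
  obtain ⟨r, hr, rfl⟩ : ∃ r : ℝ, 0 < r ∧ c = ENNReal.ofReal r :=
    ⟨c.toReal, ENNReal.toReal_pos h0 htop, (ENNReal.ofReal_toReal htop).symm⟩
  have hm : Measurable ((Set.Ioi (0 : ℝ)).indicator fun s => φ (ENNReal.ofReal s)) :=
    (by fun_prop : Measurable fun s => φ (ENNReal.ofReal s)).indicator measurableSet_Ioi
  have hmap := Real.map_volume_mul_right (inv_ne_zero hr.ne')
  rw [inv_inv, abs_of_pos hr] at hmap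
  rw [← lintegral_indicator measurableSet_Ioi, ← lintegral_indicator measurableSet_Ioi,
    ← smul_eq_mul, ← lintegral_smul_measure, ← hmap, lintegral_map hm (by fun_prop)]
  refine lintegral_congr fun u => ?_
  by_cases hu : 0 < u
  · have : 0 < u * r⁻¹ := by positivity
    simp [hu, this, ENNReal.ofReal_mul hu.le, ENNReal.ofReal_inv_of_pos hr]
  · have : ¬ 0 < u * r⁻¹ := by
      rw [not_lt] at hu ⊢
      exact mul_nonpos_of_nonpos_of_nonneg hu (by positivity)
    simp [hu, this]

/-- The Mecke formula for the tilted times of a marked Poisson process of rate `1`: they form a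
Poisson process of intensity `f • Q ⊗ volume`. -/
lemma tsum_lintegral_tiltedTime_skipAt {𝒵 : Type*} [MeasurableSpace 𝒵] (Q : Measure 𝒵)
    [IsProbabilityMeasure Q] {f : 𝒵 → ℝ≥0∞} (hf : Measurable f) (hfin : ∀ᵐ a ∂Q, f a ≠ ∞)
    {h : 𝒵 → ℝ≥0∞ → (ℕ → ℝ≥0∞) → ℝ≥0∞}
    (hh : Measurable fun q : 𝒵 × ℝ≥0∞ × (ℕ → ℝ≥0∞) => h q.1 q.2.1 q.2.2)
    (htop : ∀ a σ, h a ∞ σ = 0) :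
    ∑' k, ∫⁻ p, h (p.1 k) (tiltedTime f p.1 p.2 k) (fun i => tiltedTime f p.1 p.2 (skipAt k i))
        ∂sourceLaw Q
      = ∫⁻ a, f a * ∫⁻ s in Set.Ioi (0 : ℝ), ∫⁻ p, h a (ENNReal.ofReal s)
          (tiltedTime f p.1 p.2) ∂sourceLaw Q ∂volume ∂Q := by
  classical
  have htilt : Measurable fun p : (ℕ → 𝒵) × (ℕ → ℝ) => tiltedTime f p.1 p.2 :=
    Measurable.tiltedTime (f := fun _ => f) (by fun_prop) (by fun_prop) (by fun_prop)
  have hT : Measurable fun q : 𝒵 × ℝ =>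
      if f q.1 = 0 then ∞ else ENNReal.ofReal q.2 * (f q.1)⁻¹ :=
    Measurable.ite ((hf.comp measurable_fst) (measurableSet_singleton 0)) measurable_const
      (by fun_prop)
  refine (tsum_lintegral_sourceLaw_skipAt Q (H := fun a u p => h a
    (if f a = 0 then ∞ else ENNReal.ofReal u * (f a)⁻¹) (tiltedTime f p.1 p.2)) ?_).trans ?_
  · exact hh.comp (measurable_fst.prodMk ((hT.comp (measurable_fst.prodMk
      (measurable_fst.comp measurable_snd))).prodMk
      (htilt.comp (measurable_snd.comp measurable_snd))))
  refine lintegral_congr_ae (hfin.mono fun a ha => ?_)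
  -- Where the density vanishes the tilted time is `∞`, and `htop` makes both sides `0`.
  by_cases h0 : f a = 0
  · simp [h0, htop]
  · simp only [h0, if_false]
    refine lintegral_Ioi_mul_inv (φ := fun s => ∫⁻ p, h a s (tiltedTime f p.1 p.2) ∂sourceLaw Q)
      ?_ h0 ha
    exact Measurable.lintegral_prod_right'
      (f := fun q : ℝ≥0∞ × ((ℕ → 𝒵) × (ℕ → ℝ)) => h a q.1 (tiltedTime f q.2.1 q.2.2))
      (hh.comp (measurable_const.prodMk (measurable_fst.prodMk (htilt.comp measurable_snd))))

/-! ### Selection probabilities of a deterministic sequence of times. -/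

lemma pprProb_eq_seqCons (α : ℝ≥0∞) (s : ℕ → ℝ≥0∞) (k : ℕ) :
    pprProb α s k = pprProb α (seqCons (s k) fun i => s (skipAt k i)) 0 := by
  unfold pprProb
  split_ifs with hα h1 h2 h2
  · rfl
  · refine absurd (fun i => ?_) h2
    cases i with
    | zero => exact le_rfl
    | succ i => exact h1 _
  · refine absurd (fun i => ?_) h1
    by_cases hi : i = k
    · rw [hi]
    · obtain ⟨j, rfl⟩ := exists_skipAt_eq hi
      exact h2 (j + 1)
  · rfl
  · rw [tsum_eq_add_tsum_skipAt _ k, tsum_eq_zero_add' (f := fun i =>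
      seqCons (s k) (fun i => s (skipAt k i)) i ^ (-α.toReal)) ENNReal.summable]
    rfl

/-- Points at infinite time are never selected, so discarding them, as the Mecke formula for tilted
times requires, loses nothing. -/
lemma pprProb_eq_zero {α : ℝ≥0∞} (hα : 1 < α) {s : ℕ → ℝ≥0∞} (hs : ∃ i, s i ≠ ∞) {k : ℕ}
    (hk : s k = ∞) : pprProb α s k = 0 := by
  obtain ⟨i, hi⟩ := hs
  unfold pprProb
  split_ifs with h h1
  · exact absurd (top_le_iff.1 (hk ▸ h1 i)) hi
  · rfl
  · have : 0 < α.toReal := ENNReal.toReal_pos (zero_lt_one.trans hα).ne' h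
    rw [hk, ENNReal.top_rpow_of_neg (by linarith), ENNReal.zero_div]

lemma tsum_pprProb_top {s : ℕ → ℝ≥0∞} (hs : ∃ i, s i ≠ ∞)
    (hfin : ∀ n : ℕ, {k | s k ≤ n}.Finite) (hties : ∀ k, s k ≠ ∞ → ∀ i, s (skipAt k i) ≠ s k) :
    ∑' k, pprProb ∞ s k = 1 := by
  classical
  obtain ⟨j, hj⟩ := hs
  obtain ⟨n, hn⟩ := ENNReal.exists_nat_gt hj
  obtain ⟨k, hk, hmin⟩ := (hfin n).toFinset.exists_min_image s ⟨j, by simpa using hn.le⟩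
  simp only [Set.Finite.mem_toFinset, Set.mem_ofPred_eq] at hk hmin
  have hmin' : ∀ i, s k ≤ s i := fun i => by
    by_cases hi : s i ≤ n
    · exact hmin i hi
    · exact hk.trans (not_le.1 hi).le
  have hktop : s k ≠ ∞ := ne_top_of_le_ne_top (ENNReal.natCast_ne_top n) hk
  have hprob : ∀ i, pprProb ∞ s i = if i = k then 1 else 0 := by
    intro i
    simp only [pprProb, if_true]
    refine if_congr ⟨fun h => ?_, fun h => h ▸ hmin'⟩ rfl rfl
    by_contra hik
    obtain ⟨l, rfl⟩ := exists_skipAt_eq hik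
    exact hties k hktop l ((h k).antisymm (hmin' _))
  simp only [hprob, tsum_ite_eq]

/-- The power is not integrable near `0`, so the times up to `1` are controlled by their finite
number and only the rest by a sum. -/
lemma tsum_rpow_ne_top {s : ℕ → ℝ≥0∞} {a : ℝ} (h0 : ∀ k, s k ≠ 0)
    (hfin : {k | s k ≤ 1}.Finite)
    (hsum : ∑' k, (if s k ≤ 1 then 0 else s k ^ (-a)) ≠ ∞) (ha : 0 < a) :
    ∑' k, s k ^ (-a) ≠ ∞ := by
  classical
  have hle : ∀ k, s k ^ (-a) ≤ (if s k ≤ 1 then s k ^ (-a) else 0) +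
      (if s k ≤ 1 then 0 else s k ^ (-a)) := fun k => by split_ifs <;> simp
  refine ne_top_of_le_ne_top ?_ (ENNReal.tsum_le_tsum hle)
  rw [ENNReal.tsum_add]
  refine ENNReal.add_ne_top.2 ⟨?_, hsum⟩
  rw [tsum_eq_sum (s := hfin.toFinset)]
  · refine ENNReal.sum_ne_top.2 fun k _ => ?_
    split_ifs
    · rw [ENNReal.rpow_neg]
      exact ENNReal.inv_ne_top.2 (ENNReal.rpow_pos_of_nonneg (pos_iff_ne_zero.2 (h0 k)) ha.le).ne'
    · simp
  · intro k hk
    simp only [Set.Finite.mem_toFinset, Set.mem_ofPred_eq] at hk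
    simp [hk]

lemma tsum_pprProb_of_ne_top {α : ℝ≥0∞} (hα : 1 < α) (hα' : α ≠ ∞) {s : ℕ → ℝ≥0∞}
    (h0 : ∀ k, s k ≠ 0) (hs : ∃ i, s i ≠ ∞) (hsum : ∑' k, s k ^ (-α.toReal) ≠ ∞) :
    ∑' k, pprProb α s k = 1 := by
  obtain ⟨j, hj⟩ := hs
  have hpos : ∑' k, s k ^ (-α.toReal) ≠ 0 := by
    intro h
    have := ENNReal.tsum_eq_zero.1 h j
    rw [ENNReal.rpow_eq_zero_iff] at this
    have h1 : 0 < α.toReal := ENNReal.toReal_pos (zero_lt_one.trans hα).ne' hα'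
    rcases this with ⟨h, -⟩ | ⟨h, -⟩
    exacts [h0 j h, hj h]
  simp only [pprProb, hα', if_false, div_eq_mul_inv]
  rw [ENNReal.tsum_mul_right, ENNReal.mul_inv_cancel hpos hsum]

/-! ### Fixed input: well-definedness and exactness. -/

section FixedInput

variable {𝒵 : Type*} [MeasurableSpace 𝒵]

lemma ae_sourceLaw_fst (Q : Measure 𝒵) [IsProbabilityMeasure Q] {p : (ℕ → 𝒵) → Prop}
    (h : ∀ᵐ z ∂Measure.infinitePi (fun _ : ℕ => Q), p z) : ∀ᵐ q ∂sourceLaw Q, p q.1 :=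
  Measure.quasiMeasurePreserving_fst.ae h

/-- The exceptional event is a first zero followed by a copy of itself, so its probability equals
itself times `Q {a | f a = 0} < 1`. -/
lemma ae_infinitePi_exists (Q : Measure 𝒵) [IsProbabilityMeasure Q] {f : 𝒵 → ℝ≥0∞}
    (hf : Measurable f) (h1 : ∫⁻ a, f a ∂Q ≠ 0) :
    ∀ᵐ z ∂Measure.infinitePi (fun _ : ℕ => Q), ∃ i, f (z i) ≠ 0 := by
  set N : Set (ℕ → 𝒵) := {z | ∀ i, f (z i) = 0} with hN
  have hNm : MeasurableSet N := by
    simp only [hN, Set.ofPred_forall]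
    exact .iInter fun i => (hf.comp (measurable_pi_apply i)) (measurableSet_singleton 0)
  have h0m : MeasurableSet {a | f a = 0} := hf (measurableSet_singleton 0)
  have hlt : Q {a | f a = 0} < 1 := by
    refine lt_of_le_of_ne prob_le_one fun h => h1 ?_
    rw [lintegral_eq_zero_iff hf]
    exact (prob_compl_eq_zero_iff h0m).2 h
  suffices hz : (Measure.infinitePi fun _ : ℕ => Q) N = 0 by
    rw [ae_iff]
    simpa using hz
  by_contra hne
  have hfin := measure_ne_top (Measure.infinitePi fun _ : ℕ => Q) N
  have heq : (Measure.infinitePi fun _ : ℕ => Q) N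
      = Q {a | f a = 0} * (Measure.infinitePi fun _ : ℕ => Q) N := by
    conv_lhs => rw [← map_seqCons_infinitePi Q, Measure.map_apply (by fun_prop) hNm]
    rw [← Measure.prod_prod]
    congr 1
    ext p
    simp only [hN, Set.mem_preimage, Set.mem_ofPred_eq, Set.mem_prod]
    refine ⟨fun h => ⟨h 0, fun i => h (i + 1)⟩, fun h i => ?_⟩
    cases i with
    | zero => exact h.1
    | succ i => exact h.2 i
  have := ENNReal.mul_lt_mul_left hne hfin hlt
  rw [one_mul, ← heq] at this
  exact lt_irrefl _ this

variable (Q : Measure 𝒵) [IsProbabilityMeasure Q] {f : 𝒵 → ℝ≥0∞}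

lemma ae_tiltedTime_ne_zero (hf : ∀ᵐ a ∂Q, f a ≠ ∞) :
    ∀ᵐ p ∂sourceLaw Q, ∀ k, tiltedTime f p.1 p.2 k ≠ 0 := by
  have h1 : ∀ᵐ z ∂Measure.infinitePi (fun _ : ℕ => Q), ∀ k, f (z k) ≠ ∞ :=
    ae_all_iff.2 fun k => (measurePreserving_eval_infinitePi
      (fun _ : ℕ => Q) k).quasiMeasurePreserving.ae hf
  have h2 : ∀ᵐ p ∂sourceLaw Q, ∀ i, 0 < p.2 i :=
    Measure.quasiMeasurePreserving_snd.ae ae_poissonLaw_pos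
  filter_upwards [ae_sourceLaw_fst Q h1, h2] with p hp1 hp2 k
  unfold tiltedTime
  split_ifs
  · simp
  · simp [hp1 k, hp2 k]

lemma ae_exists_tiltedTime_ne_top (hf : Measurable f) (h1 : ∫⁻ a, f a ∂Q ≠ 0) :
    ∀ᵐ p ∂sourceLaw Q, ∃ k, tiltedTime f p.1 p.2 k ≠ ∞ := by
  filter_upwards [ae_sourceLaw_fst Q (ae_infinitePi_exists Q hf h1)] with p hp
  obtain ⟨k, hk⟩ := hp
  refine ⟨k, ?_⟩
  rw [tiltedTime, if_neg hk]
  exact ENNReal.mul_ne_top ENNReal.ofReal_ne_top (ENNReal.inv_ne_top.2 hk)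

lemma measurable_tiltedTime_sourceLaw (hf : Measurable f) :
    Measurable fun p : (ℕ → 𝒵) × (ℕ → ℝ) => tiltedTime f p.1 p.2 :=
  Measurable.tiltedTime (f := fun _ => f) (by fun_prop) (by fun_prop) (by fun_prop)

/-- Campbell's formula for the tilted times. -/
lemma lintegral_tsum_tiltedTime (hf : Measurable f) (h1 : ∫⁻ a, f a ∂Q = 1)
    {φ : ℝ≥0∞ → ℝ≥0∞} (hφ : Measurable φ) (htop : φ ∞ = 0) :
    ∫⁻ p, ∑' k, φ (tiltedTime f p.1 p.2 k) ∂sourceLaw Q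
      = ∫⁻ s in Set.Ioi (0 : ℝ), φ (ENNReal.ofReal s) := by
  have htilt := measurable_tiltedTime_sourceLaw hf
  rw [lintegral_tsum fun k => by fun_prop, tsum_lintegral_tiltedTime_skipAt Q hf
    ((ae_lt_top hf (h1.trans_ne ENNReal.one_ne_top)).mono fun _ h => h.ne)
    (h := fun _ s _ => φ s) (by fun_prop) (fun _ _ => htop)]
  simp only [lintegral_const, measure_univ, mul_one]
  rw [lintegral_mul_const _ hf, h1, one_mul]

lemma ae_finite_tiltedTime_le (hf : Measurable f) (h1 : ∫⁻ a, f a ∂Q = 1) :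
    ∀ᵐ p ∂sourceLaw Q, ∀ n : ℕ, {k | tiltedTime f p.1 p.2 k ≤ n}.Finite := by
  have htilt := measurable_tiltedTime_sourceLaw hf
  refine ae_all_iff.2 fun n => ?_
  have hφ : Measurable ((Set.Iic (n : ℝ≥0∞)).indicator (1 : ℝ≥0∞ → ℝ≥0∞)) :=
    measurable_one.indicator measurableSet_Iic
  have hC := lintegral_tsum_tiltedTime Q hf h1 hφ (by simp)
  have hlt : ∫⁻ s in Set.Ioi (0 : ℝ),
      (Set.Iic (n : ℝ≥0∞)).indicator (1 : ℝ≥0∞ → ℝ≥0∞) (ENNReal.ofReal s) ≠ ∞ := by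
    have : ∀ s : ℝ, (Set.Ioi (0 : ℝ)).indicator (fun s => (Set.Iic (n : ℝ≥0∞)).indicator
        (1 : ℝ≥0∞ → ℝ≥0∞) (ENNReal.ofReal s)) s ≤ (Set.Ioc (0 : ℝ) n).indicator 1 s := by
      intro s
      by_cases hs : 0 < s <;> by_cases hn : s ≤ n <;>
        simp [hs, hn, Set.indicator, ENNReal.ofReal_le_natCast]
    rw [← lintegral_indicator measurableSet_Ioi]
    refine ne_top_of_le_ne_top ?_ (lintegral_mono this)
    rw [lintegral_indicator_one measurableSet_Ioc]
    simp
  filter_upwards [ae_lt_top (by fun_prop) (hC.trans_ne hlt)] with p hp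
  refine (ENNReal.finite_const_le_of_tsum_ne_top hp.ne one_ne_zero).subset fun k hk => ?_
  simp only [Set.mem_ofPred_eq] at hk ⊢
  simp [hk]

lemma ae_tsum_tiltedTime_rpow_ne_top (hf : Measurable f) (h1 : ∫⁻ a, f a ∂Q = 1) {a : ℝ}
    (ha : 1 < a) : ∀ᵐ p ∂sourceLaw Q, ∑' k, tiltedTime f p.1 p.2 k ^ (-a) ≠ ∞ := by
  have htilt := measurable_tiltedTime_sourceLaw hf
  have hφ : Measurable fun s : ℝ≥0∞ => if s ≤ 1 then 0 else s ^ (-a) :=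
    Measurable.ite measurableSet_Iic measurable_const (by fun_prop)
  have hC := lintegral_tsum_tiltedTime Q hf h1 hφ (by
    simp [ENNReal.top_rpow_of_neg (show -a < 0 by linarith)])
  have hlt : ∫⁻ s in Set.Ioi (0 : ℝ),
      (if ENNReal.ofReal s ≤ 1 then 0 else ENNReal.ofReal s ^ (-a)) ≠ ∞ := by
    have heq : ∫⁻ s in Set.Ioi (0 : ℝ),
        (if ENNReal.ofReal s ≤ 1 then 0 else ENNReal.ofReal s ^ (-a))
        = ∫⁻ s in Set.Ioi (1 : ℝ), ENNReal.ofReal (s ^ (-a)) := by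
      rw [← lintegral_indicator measurableSet_Ioi, ← lintegral_indicator measurableSet_Ioi]
      refine lintegral_congr fun s => ?_
      by_cases hs : 1 < s
      · have : 0 < s := by linarith
        simp [hs, this, ENNReal.ofReal_rpow_of_pos this]
      · simp [hs, Set.indicator]
    rw [heq]
    -- The tail integral of `s ^ (-a)` converges because `1 < a`.
    exact (integrableOn_Ioi_rpow_of_lt (by linarith) one_pos).lintegral_lt_top.ne
  filter_upwards [ae_lt_top (Measurable.tsum fun k =>
    hφ.comp ((measurable_pi_apply k).comp htilt)) (hC.trans_ne hlt), ae_finite_tiltedTime_le Q hf h1,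
    ae_tiltedTime_ne_zero Q ((ae_lt_top hf (h1.trans_ne ENNReal.one_ne_top)).mono
      fun _ h => h.ne)] with p hp hfin h0
  exact tsum_rpow_ne_top h0 (by simpa using hfin 1) hp.ne (by linarith)

/-- By the Mecke formula, the expected number of finite times tied with another is an integral over
an extra time `s` of the event that `s` hits a countable set, which is Lebesgue null. -/
lemma ae_tiltedTime_skipAt_ne (hf : Measurable f) (h1 : ∫⁻ a, f a ∂Q = 1) :
    ∀ᵐ p ∂sourceLaw Q, ∀ k, tiltedTime f p.1 p.2 k ≠ ∞ →
      ∀ i, tiltedTime f p.1 p.2 (skipAt k i) ≠ tiltedTime f p.1 p.2 k := by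
  have htilt := measurable_tiltedTime_sourceLaw hf
  set E : Set (ℝ≥0∞ × (ℕ → ℝ≥0∞)) := {q | q.1 ≠ ∞ ∧ ∃ i, q.2 i = q.1} with hE
  have hEm : MeasurableSet E := by
    have : E = {q | q.1 ≠ ∞} ∩ ⋃ i, {q | q.2 i = q.1} := by
      ext
      simp [hE]
    rw [this]
    exact (measurable_fst (measurableSet_singleton ∞).compl).inter
      (.iUnion fun i => measurableSet_eq_fun (by fun_prop) (by fun_prop))
  have hind : Measurable (E.indicator (1 : ℝ≥0∞ × (ℕ → ℝ≥0∞) → ℝ≥0∞)) :=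
    measurable_one.indicator hEm
  have hM := tsum_lintegral_tiltedTime_skipAt Q hf
    ((ae_lt_top hf (h1.trans_ne ENNReal.one_ne_top)).mono fun _ h => h.ne)
    (h := fun _ s τ => E.indicator 1 (s, τ)) (by fun_prop) (fun _ _ => by simp [hE])
  have hzero : ∫⁻ s in Set.Ioi (0 : ℝ), ∫⁻ p, E.indicator (1 : ℝ≥0∞ × (ℕ → ℝ≥0∞) → ℝ≥0∞)
      (ENNReal.ofReal s, tiltedTime f p.1 p.2) ∂sourceLaw Q = 0 := by
    rw [lintegral_lintegral_swap (by fun_prop)]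
    refine (lintegral_congr fun p => ?_).trans lintegral_zero
    refine (setLIntegral_congr_fun_ae measurableSet_Ioi ?_).trans lintegral_zero
    have hc : (Set.range fun i => (tiltedTime f p.1 p.2 i).toReal).Countable :=
      Set.countable_range _
    filter_upwards [hc.ae_notMem volume] with s hs hs0
    refine Set.indicator_of_notMem (fun hmem => hs ?_) _
    obtain ⟨i, hi⟩ := hmem.2
    exact ⟨i, by simp only at hi; simp [hi, (Set.mem_Ioi.1 hs0).le]⟩
  simp only [hzero, mul_zero, lintegral_zero, ENNReal.tsum_eq_zero] at hM
  refine ae_all_iff.2 fun k => ?_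
  have hk := hM k
  rw [lintegral_eq_zero_iff (by fun_prop)] at hk
  filter_upwards [hk] with p hp hne i hi
  have hmem : (tiltedTime f p.1 p.2 k, fun i => tiltedTime f p.1 p.2 (skipAt k i)) ∈ E :=
    ⟨hne, i, hi⟩
  simp [hmem] at hp

lemma ae_tsum_pprProb (hf : Measurable f) (h1 : ∫⁻ a, f a ∂Q = 1) {α : ℝ≥0∞} (hα : 1 < α) :
    ∀ᵐ p ∂sourceLaw Q, ∑' k, pprProb α (tiltedTime f p.1 p.2) k = 1 := by
  have hex := ae_exists_tiltedTime_ne_top Q hf (h1.trans_ne one_ne_zero)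
  by_cases hα' : α = ∞
  · subst hα'
    filter_upwards [hex, ae_finite_tiltedTime_le Q hf h1, ae_tiltedTime_skipAt_ne Q hf h1]
      with p h2 h3 h4
    exact tsum_pprProb_top h2 h3 h4
  · have ha : 1 < α.toReal := by
      rwa [← ENNReal.toReal_one, ENNReal.toReal_lt_toReal ENNReal.one_ne_top hα']
    filter_upwards [hex, ae_tsum_tiltedTime_rpow_ne_top Q hf h1 ha, ae_tiltedTime_ne_zero Q
      ((ae_lt_top hf (h1.trans_ne ENNReal.one_ne_top)).mono fun _ h => h.ne)] with p h2 h3 h4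
    exact tsum_pprProb_of_ne_top hα hα' h4 h2 h3

/-- Exactness of the Poisson private representation for a fixed input: the selected sample has
density `f` with respect to the proposal `Q`. -/
lemma tsum_lintegral_pprProb (hf : Measurable f) (h1 : ∫⁻ a, f a ∂Q = 1) {α : ℝ≥0∞}
    (hα : 1 < α) {A : Set 𝒵} (hA : MeasurableSet A) :
    ∑' k, ∫⁻ p, A.indicator 1 (p.1 k) * pprProb α (tiltedTime f p.1 p.2) k ∂sourceLaw Q
      = ∫⁻ a in A, f a ∂Q := by
  classical
  have htilt := measurable_tiltedTime_sourceLaw hf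
  have hppr := measurable_pprProb α
  have hex := ae_exists_tiltedTime_ne_top Q hf (h1.trans_ne one_ne_zero)
  set C : ℝ≥0∞ := ∫⁻ s in Set.Ioi (0 : ℝ), ∫⁻ p,
    pprProb α (seqCons (ENNReal.ofReal s) (tiltedTime f p.1 p.2)) 0 ∂sourceLaw Q with hC
  have key : ∀ B : Set 𝒵, MeasurableSet B →
      ∑' k, ∫⁻ p, B.indicator 1 (p.1 k) * pprProb α (tiltedTime f p.1 p.2) k ∂sourceLaw Q
        = (∫⁻ a in B, f a ∂Q) * C := by
    intro B hB
    have hBi : Measurable (B.indicator (1 : 𝒵 → ℝ≥0∞)) := measurable_one.indicator hB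
    have hM := tsum_lintegral_tiltedTime_skipAt Q hf
      ((ae_lt_top hf (h1.trans_ne ENNReal.one_ne_top)).mono fun _ h => h.ne)
      -- The cut-off at `∞` meets the vanishing condition of the Mecke formula; `pprProb_eq_zero`
      -- shows that it changes nothing almost surely.
      (h := fun a s τ => if s = ∞ then 0 else B.indicator 1 a * pprProb α (seqCons s τ) 0)
      (Measurable.ite ((measurable_fst.comp measurable_snd) (measurableSet_singleton ∞))
        measurable_const (by fun_prop)) (fun _ _ => if_pos rfl)
    simp only [ENNReal.ofReal_ne_top, if_false] at hM
    refine ((tsum_congr fun k => lintegral_congr_ae ?_).trans hM).trans ?_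
    · filter_upwards [hex] with p hp
      split_ifs with h
      · rw [pprProb_eq_zero hα hp h, mul_zero]
      · rw [pprProb_eq_seqCons]
    · have : ∀ a, f a * ∫⁻ s in Set.Ioi (0 : ℝ), ∫⁻ p, B.indicator 1 a *
          pprProb α (seqCons (ENNReal.ofReal s) (tiltedTime f p.1 p.2)) 0 ∂sourceLaw Q
          = B.indicator f a * C := by
        intro a
        by_cases ha : a ∈ B <;> simp [ha, hC]
      simp only [this]
      rw [lintegral_mul_const _ (hf.indicator hB), lintegral_indicator hB]
  have hC1 : C = 1 := by
    have := key Set.univ .univ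
    simp only [Set.indicator_univ, Pi.one_apply, one_mul, Measure.restrict_univ, h1] at this
    rw [← this, ← lintegral_tsum fun k => by fun_prop,
      lintegral_congr_ae (ae_tsum_pprProb Q hf h1 hα)]
    simp
  rw [key A hA, hC1, mul_one]

end FixedInput

/-! ### Transfer to the given random variables and a random input. -/

lemma interarrival_apply_succ {Ω : Type*} (T : ℕ → Ω → ℝ) (i : ℕ) (ω : Ω) :
    interarrival T (i + 1) ω = T (i + 1) ω - T i ω := rfl

lemma arrival_interarrival {Ω : Type*} (T : ℕ → Ω → ℝ) (ω : Ω) :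
    arrival (fun i => interarrival T i ω) = fun i => T i ω := by
  funext i
  induction i with
  | zero => simp [arrival, interarrival]
  | succ i ih =>
    unfold arrival at ih ⊢
    rw [Finset.sum_range_succ, ih, interarrival_apply_succ]
    ring

lemma IsUnitPoissonProcess.map_eq {Ω : Type*} [MeasurableSpace Ω] {μ : Measure Ω}
    {T : ℕ → Ω → ℝ} (hT : IsUnitPoissonProcess μ T) :
    μ.map (fun ω i => T i ω) = poissonLaw := by
  have hm : ∀ i, Measurable (interarrival T i) := fun i => by
    cases i with
    | zero => exact hT.measurable 0
    | succ i => exact (hT.measurable (i + 1)).sub (hT.measurable i)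
  have hgap := hT.iIndepFun_interarrival.map_fun_eq_infinitePi_map hm
  simp only [fun i => (hT.hasLaw_interarrival i).map_eq] at hgap
  rw [poissonLaw, gapLaw, ← hgap, Measure.map_map measurable_arrival (measurable_pi_iff.2 hm)]
  congr 1
  funext ω
  exact (arrival_interarrival T ω).symm

section

variable {Ω 𝒳 𝒵 : Type*} [MeasurableSpace Ω] [MeasurableSpace 𝒳] [MeasurableSpace 𝒵]
  {μ : Measure Ω} {Q : Measure 𝒵}
  {X : Ω → 𝒳} {Z : ℕ → Ω → 𝒵} {T : ℕ → Ω → ℝ}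

lemma IsPPRSource.measurable_pair (h : IsPPRSource μ Q X Z T) :
    Measurable fun ω => ((fun i => Z i ω : ℕ → 𝒵), (fun i => T i ω : ℕ → ℝ)) :=
  (measurable_pi_iff.2 h.measurable_sample).prodMk (measurable_pi_iff.2 h.poisson.measurable)

lemma IsPPRSource.measurable (h : IsPPRSource μ Q X Z T) :
    Measurable fun ω => (X ω, (fun i => Z i ω : ℕ → 𝒵), (fun i => T i ω : ℕ → ℝ)) :=
  h.measurable_input.prodMk h.measurable_pair

lemma measurable_pprProb_tiltedTime {r : 𝒳 → 𝒵 → ℝ≥0∞} (hr : Measurable (Function.uncurry r))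
    (α : ℝ≥0∞) (k : ℕ) :
    Measurable fun q : 𝒳 × (ℕ → 𝒵) × (ℕ → ℝ) => pprProb α (tiltedTime (r q.1) q.2.1 q.2.2) k :=
  (measurable_pprProb α k).comp (Measurable.tiltedTime (f := fun q : 𝒳 × (ℕ → 𝒵) × (ℕ → ℝ) =>
    r q.1) (hr.comp (by fun_prop : Measurable fun q : (𝒳 × (ℕ → 𝒵) × (ℕ → ℝ)) × 𝒵 =>
      (q.1.1, q.2))) (by fun_prop) (by fun_prop))

lemma ae_setLIntegral_density_eq {P : Kernel 𝒳 𝒵} [IsMarkovKernel P] [IsProbabilityMeasure Q]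
    (hX : Measurable X) (hac : ∀ᵐ ω ∂μ, P (X ω) ≪ Q) {r : 𝒳 → 𝒵 → ℝ≥0∞}
    (hr : Measurable (Function.uncurry r))
    (hdensity : ∀ᵐ ω ∂μ, r (X ω) =ᵐ[Q] (P (X ω)).rnDeriv Q) {A : Set 𝒵} (hA : MeasurableSet A) :
    ∀ᵐ x ∂μ.map X, ∫⁻ a in A, r x a ∂Q = P x A := by
  have hm : Measurable fun x => ∫⁻ a in A, r x a ∂Q :=
    Measurable.lintegral_prod_right' (f := Function.uncurry r) hr
  rw [ae_map_iff hX.aemeasurable (measurableSet_eq_fun hm (P.measurable_coe hA))]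
  filter_upwards [hac, hdensity] with ω h1 h2
  rw [lintegral_congr_ae (ae_restrict_of_ae h2), Measure.setLIntegral_rnDeriv h1]

variable [IsProbabilityMeasure μ]

lemma IsPPRSource.map_eq (h : IsPPRSource μ Q X Z T) :
    μ.map (fun ω => (X ω, (fun i => Z i ω : ℕ → 𝒵), (fun i => T i ω : ℕ → ℝ)))
      = (μ.map X).prod (sourceLaw Q) := by
  have hZ := h.iIndepFun_sample.map_fun_eq_infinitePi_map h.measurable_sample
  simp only [fun i => (h.hasLaw_sample i).map_eq] at hZ
  rw [h.indepFun_input.map_prod_eq_prod_map_map h.measurable_input.aemeasurable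
    h.measurable_pair.aemeasurable, h.indepFun_sample_times.map_prod_eq_prod_map_map
    (measurable_pi_iff.2 h.measurable_sample).aemeasurable
    (measurable_pi_iff.2 h.poisson.measurable).aemeasurable, hZ, h.poisson.map_eq, sourceLaw]

lemma IsPPRSource.ae_tsum_pprProb [IsProbabilityMeasure Q] (h : IsPPRSource μ Q X Z T)
    {α : ℝ≥0∞} (hα : 1 < α) {r : 𝒳 → 𝒵 → ℝ≥0∞} (hr : Measurable (Function.uncurry r))
    (h1 : ∀ᵐ x ∂μ.map X, ∫⁻ a, r x a ∂Q = 1) :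
    ∀ᵐ ω ∂μ,
      ∑' k, pprProb α (tiltedTime (r (X ω)) (fun i => Z i ω) (fun i => T i ω)) k = 1 := by
  have hm : MeasurableSet {q : 𝒳 × (ℕ → 𝒵) × (ℕ → ℝ) |
      ∑' k, pprProb α (tiltedTime (r q.1) q.2.1 q.2.2) k = 1} :=
    (Measurable.tsum fun k => measurable_pprProb_tiltedTime hr α k)
      (measurableSet_singleton 1)
  refine ae_of_ae_map (p := fun q : 𝒳 × (ℕ → 𝒵) × (ℕ → ℝ) =>
    ∑' k, pprProb α (tiltedTime (r q.1) q.2.1 q.2.2) k = 1) h.measurable.aemeasurable ?_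
  rw [h.map_eq, Measure.ae_prod_iff_ae_ae hm]
  exact h1.mono fun x hx => _root_.ae_tsum_pprProb Q hr.of_uncurry_left hx hα

/-- This is the defining property of conditional expectation on an event of the source, rewritten in
`ℝ≥0∞`; almost sure summation to `1` bounds the probabilities and makes the passage through `toReal`
faithful. -/
lemma IsPPRIndex.measure_inter {α : ℝ≥0∞} {r : 𝒳 → 𝒵 → ℝ≥0∞} {K : Ω → ℕ}
    (hK : IsPPRIndex μ α r X Z T K) (h : IsPPRSource μ Q X Z T)
    (hr : Measurable (Function.uncurry r))
    (hprob : ∀ᵐ ω ∂μ,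
      ∑' k, pprProb α (tiltedTime (r (X ω)) (fun i => Z i ω) (fun i => T i ω)) k = 1)
    {D : Set (𝒳 × (ℕ → 𝒵) × (ℕ → ℝ))} (hD : MeasurableSet D) (k : ℕ) :
    μ ((fun ω => (X ω, (fun i => Z i ω : ℕ → 𝒵), (fun i => T i ω : ℕ → ℝ))) ⁻¹' D ∩ K ⁻¹' {k})
      = ∫⁻ q in D, pprProb α (tiltedTime (r q.1) q.2.1 q.2.2) k ∂(μ.map X).prod (sourceLaw Q) := by
  set W := fun ω => (X ω, (fun i => Z i ω : ℕ → 𝒵), (fun i => T i ω : ℕ → ℝ)) with hW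
  have hWm : Measurable W := h.measurable
  have hpm := measurable_pprProb_tiltedTime hr α k
  have hpWm : Measurable fun ω =>
      pprProb α (tiltedTime (r (X ω)) (fun i => Z i ω) (fun i => T i ω)) k := hpm.comp hWm
  have hle : ∀ᵐ ω ∂μ, pprProb α (tiltedTime (r (X ω)) (fun i => Z i ω) (fun i => T i ω)) k ≤ 1 :=
    hprob.mono fun ω hω => (ENNReal.le_tsum k).trans_eq hω
  have hKm : MeasurableSet (K ⁻¹' {k}) := hK.measurable (measurableSet_singleton k)
  have hset := setIntegral_condExp hWm.comap_le
    ((integrable_const (μ := μ) (1 : ℝ)).indicator hKm) ⟨D, hD, rfl⟩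
  rw [setIntegral_congr_ae (hWm hD) ((hK.condProb k).mono fun ω hω _ => hω),
    integral_toReal hpWm.aemeasurable (ae_restrict_of_ae
      (hle.mono fun ω hω => hω.trans_lt ENNReal.one_lt_top)),
    integral_indicator hKm, Measure.restrict_restrict hKm] at hset
  simp only [integral_const, smul_eq_mul, mul_one, Measure.real, Measure.restrict_apply .univ,
    Set.univ_inter] at hset
  rw [← h.map_eq, setLIntegral_map hD hpm hWm, Set.inter_comm]
  refine ((ENNReal.toReal_eq_toReal_iff' ?_ (measure_ne_top _ _)).1 hset).symm
  refine ne_top_of_le_ne_top ENNReal.one_ne_top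
    ((lintegral_mono_ae (ae_restrict_of_ae hle)).trans ?_)
  simpa using prob_le_one

lemma IsPPRIndex.hasCondDistrib [IsProbabilityMeasure Q] {P : Kernel 𝒳 𝒵} [IsMarkovKernel P]
    {α : ℝ≥0∞} (hα : 1 < α) {r : 𝒳 → 𝒵 → ℝ≥0∞} {K : Ω → ℕ}
    (hK : IsPPRIndex μ α r X Z T K) (h : IsPPRSource μ Q X Z T)
    (hr : Measurable (Function.uncurry r))
    (hdensity : ∀ A, MeasurableSet A → ∀ᵐ x ∂μ.map X, ∫⁻ a in A, r x a ∂Q = P x A) :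
    HasCondDistrib (fun ω => Z (K ω) ω) X P μ := by
  have h1 : ∀ᵐ x ∂μ.map X, ∫⁻ a, r x a ∂Q = 1 := by
    simpa using hdensity Set.univ .univ
  have hprob := h.ae_tsum_pprProb hα hr h1
  have hZK : Measurable fun ω => Z (K ω) ω :=
    (measurable_from_prod_countable_right (f := fun p : ℕ × Ω => Z p.1 p.2)
      h.measurable_sample).comp (hK.measurable.prodMk measurable_id)
  have hXZ : Measurable fun ω => (X ω, Z (K ω) ω) := h.measurable_input.prodMk hZK
  have : IsProbabilityMeasure (μ.map X) :=
    Measure.isProbabilityMeasure_map h.measurable_input.aemeasurable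
  refine ⟨hXZ.aemeasurable, ?_⟩
  have : IsProbabilityMeasure (μ.map fun ω => (X ω, Z (K ω) ω)) :=
    Measure.isProbabilityMeasure_map hXZ.aemeasurable
  refine Measure.ext_prod fun {B A} hB hA => ?_
  have hDm : ∀ k, MeasurableSet {q : 𝒳 × (ℕ → 𝒵) × (ℕ → ℝ) | q.1 ∈ B ∧ q.2.1 k ∈ A} := fun k =>
    (measurable_fst hB).inter
      ((by fun_prop : Measurable fun q : 𝒳 × (ℕ → 𝒵) × (ℕ → ℝ) => q.2.1 k) hA)
  have hpm := measurable_pprProb_tiltedTime hr α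
  have hAi : Measurable (A.indicator (1 : 𝒵 → ℝ≥0∞)) := measurable_one.indicator hA
  -- On `K = k` the output is `Z k`, a function of the source, so each piece falls under
  -- `IsPPRIndex.measure_inter`.
  have hsplit : (fun ω => (X ω, Z (K ω) ω)) ⁻¹' B ×ˢ A
      = ⋃ k, (fun ω => (X ω, (fun i => Z i ω : ℕ → 𝒵), (fun i => T i ω : ℕ → ℝ))) ⁻¹'
          {q | q.1 ∈ B ∧ q.2.1 k ∈ A} ∩ K ⁻¹' {k} := by
    ext ω
    simp
  have hk : ∀ k, ∫⁻ q in {q : 𝒳 × (ℕ → 𝒵) × (ℕ → ℝ) | q.1 ∈ B ∧ q.2.1 k ∈ A},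
        pprProb α (tiltedTime (r q.1) q.2.1 q.2.2) k ∂(μ.map X).prod (sourceLaw Q)
      = ∫⁻ x in B, ∫⁻ p, A.indicator 1 (p.1 k) * pprProb α (tiltedTime (r x) p.1 p.2) k
          ∂sourceLaw Q ∂μ.map X := by
    intro k
    rw [← lintegral_indicator (hDm k), ← lintegral_indicator hB,
      lintegral_prod _ ((hpm k).indicator (hDm k)).aemeasurable]
    refine lintegral_congr fun x => ?_
    by_cases hx : x ∈ B
    · simp only [Set.indicator_of_mem hx]
      refine lintegral_congr fun p => ?_
      by_cases hp : p.1 k ∈ A <;> simp [Set.indicator, hx, hp]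
    · simp [Set.indicator, hx]
  rw [Measure.map_apply hXZ (hB.prod hA), hsplit, measure_iUnion, Measure.compProd_apply_prod hB hA]
  · simp only [hK.measure_inter h hr hprob (hDm _), hk]
    rw [← lintegral_tsum]
    · refine lintegral_congr_ae (ae_restrict_of_ae ?_)
      filter_upwards [h1, hdensity A hA] with x hx1 hxA
      rw [tsum_lintegral_pprProb Q hr.of_uncurry_left hx1 hα hA, hxA]
    · intro k
      exact (Measurable.lintegral_prod_right' (f := fun q : 𝒳 × (ℕ → 𝒵) × (ℕ → ℝ) =>
        A.indicator 1 (q.2.1 k) * pprProb α (tiltedTime (r q.1) q.2.1 q.2.2) k)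
        ((hAi.comp (by fun_prop)).mul (hpm k))).aemeasurable
  · intro i j hij
    refine Set.disjoint_left.2 fun ω hi hj => hij ?_
    exact hi.2.symm.trans hj.2
  · exact fun k => (h.measurable (hDm k)).inter (hK.measurable (measurableSet_singleton k))

end


theorem mainTheorem7 {Ω 𝒳 𝒵 : Type*} [MeasurableSpace Ω] [MeasurableSpace 𝒳] [MeasurableSpace 𝒵]
    (μ : Measure Ω) [IsProbabilityMeasure μ]
    -- the proposal distribution, the privacy mechanism and the parameter
    (Q : Measure 𝒵) [IsProbabilityMeasure Q]
    (P : Kernel 𝒳 𝒵) [IsMarkovKernel P]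
    (α : ℝ≥0∞) (hα : 1 < α)
    -- the input, the shared samples and the Poisson process
    (X : Ω → 𝒳) (Z : ℕ → Ω → 𝒵) (T : ℕ → Ω → ℝ)
    (hsource : IsPPRSource μ Q X Z T)
    (hac : ∀ᵐ ω ∂μ, P (X ω) ≪ Q)
    -- a version of the Radon-Nikodym derivative of the mechanism with respect to the proposal
    (r : 𝒳 → 𝒵 → ℝ≥0∞) (hr : Measurable (Function.uncurry r))
    (hdensity : ∀ᵐ ω ∂μ, r (X ω) =ᵐ[Q] (P (X ω)).rnDeriv Q) :
    -- the selection probabilities almost surely are a probability distribution on the indices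
    (∀ᵐ ω ∂μ,
      ∑' k, pprProb α (tiltedTime (r (X ω)) (fun i => Z i ω) (fun i => T i ω)) k = 1) ∧
    -- the output follows the mechanism exactly
    ∀ K : Ω → ℕ, IsPPRIndex μ α r X Z T K →
      HasCondDistrib (fun ω => Z (K ω) ω) X P μ ∧
      ∀ x : 𝒳, (∀ᵐ ω ∂μ, X ω = x) → HasLaw (fun ω => Z (K ω) ω) (P x) μ := by
  have hd : ∀ A, MeasurableSet A → ∀ᵐ x ∂μ.map X, ∫⁻ a in A, r x a ∂Q = P x A := fun A hA =>
    ae_setLIntegral_density_eq hsource.measurable_input hac hr hdensity hA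
  refine ⟨hsource.ae_tsum_pprProb hα hr (by simpa using hd Set.univ .univ), fun K hK => ?_⟩
  have hcond := hK.hasCondDistrib hα hsource hr hd
  refine ⟨hcond, fun x hx => ⟨hcond.aemeasurable_snd, ?_⟩⟩
  have : IsProbabilityMeasure (μ.map X) :=
    Measure.isProbabilityMeasure_map hsource.measurable_input.aemeasurable
  ext A hA
  -- The law of the output is the second marginal of the joint law, that is, the average of `P (X
  -- ω)`, which is constant when `X = x` almost surely.
  have hsnd := Measure.snd_map_prodMk₀ (μ := μ) (Y := fun ω => Z (K ω) ω)
    hsource.measurable_input.aemeasurable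
  rw [← hsnd, hcond.map_eq, Measure.snd_apply hA, ← Set.univ_prod,
    Measure.compProd_apply_prod .univ hA, Measure.restrict_univ,
    lintegral_map (P.measurable_coe hA) hsource.measurable_input,
    lintegral_congr_ae (hx.mono fun ω hω => by rw [hω])]
  simp
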